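/- Let $\Gamma=(V,E,\mathrm{wt},\nu)$ be a finite directed multigraph (loops and parallel edges allowed) with a voltage $\nu(e)\in\mathbb Z/2\mathbb Z=\{1,g\}$ and a weight $\mathrm{wt}(e)\in R$ on each edge $e$, where $R$ is a commutative ring; the principal case is that of indeterminate weights, $R=\mathbb Z[E]=\mathbb Z[x_e : e\in E]$ and $\mathrm{wt}(e)=x_e$. The derived graph $\tilde\Gamma$ is the double cover with vertex set $V\times\{1,g\}$ in which each edge $e$ from $u$ to $w$ lifts, for $x\in\{1,g\}$, to an edge from $(u,x)$ to $(w,\nu(e)x)$ of weight $\mathrm{wt}(e)$. For a vertex $v$ of a weighted graph, an arborescence rooted at $v$ is a spanning tree directed towards $v$, i.e. a set $T$ of edges such that every vertex has a unique directed path to $v$ in $T$ (repetition of vertices and edges along a path is not excluded here, so that uniqueness forces $T$ to be a tree), and $A_v$ denotes the sum of $\prod_{e\in T}\mathrm{wt}(e)$ over all arborescences $T$ rooted at $v$. Let $\mathscr L(\Gamma)=D-\mathscr A$ be the voltage Laplacian, where $D$ is the diagonal matrix with $D_{uu}=\sum_{e\text{ with source }u}\mathrm{wt}(e)$ and $\mathscr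 A_{uw}=\sum_{e\text{ from }u\text{ to }w}\nu(e)\,\mathrm{wt}(e)$. The entries of $\mathscr L(\Gamma)$ lie in the reduced group algebra $R[\mathbb Z/2\mathbb Z]/(1+g)$, which is identified with $R$ by $g\mapsto-1$. Then, for every vertex $v$ of $\Gamma$ and every lift $\tilde v$ of $v$ in $\tilde\Gamma$, $$2\,A_{\tilde v}(\tilde\Gamma)=A_v(\Gamma)\cdot\det\mathscr L(\Gamma)\quad\text{in } R.$$ Consequently, if $R$ is an integral domain in which $2\neq0$ (for instance $R=\mathbb Z[E]$) and $A_v(\Gamma)\neq0$, then in the fraction field of $R$ $$\frac{A_{\tilde v}(\tilde\Gamma)}{A_v(\Gamma)}=\frac12\det\mathscr L(\Gamma).$$ -/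

import Mathlib

/-- A finite directed multigraph with vertex set `V` and edge set `E` (loops and parallel edges
are allowed) and edge weights in `R`. Indeterminate weights are the case
`R = MvPolynomial E ℤ`, `wt = MvPolynomial.X`. -/
structure WeightedDigraph (V E R : Type*) where
  /-- the source of an edge -/
  src : E → V
  /-- the target of an edge -/
  tgt : E → V
  /-- the weight of an edge -/
  wt : E → R

namespace WeightedDigraph

variable {V E R : Type*}

/-- `Γ.IsDirectedPath T u v p`: the list of edges `p` is a directed path from `u` to `v`, i.e. a
sequence of consecutive edges of `T` starting at `u` and ending at `v` (the empty sequence is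
the path of length zero from `u` to `u`). Repetitions are not excluded. -/
def IsDirectedPath (Γ : WeightedDigraph V E R) (T : Finset E) : V → V → List E → Prop
  | u, v, [] => u = v
  | u, v, e :: p => e ∈ T ∧ Γ.src e = u ∧ IsDirectedPath Γ T (Γ.tgt e) v p

/-- A set of edges `T` is an arborescence rooted at `v` if every vertex `w` has exactly one
directed path to `v` in `T`. As paths may repeat vertices, uniqueness excludes loops,
directed cycles, edges leaving `v` and vertices with two outgoing edges, so that `T` is a spanning
tree directed towards `v`. -/
def IsArborescence (Γ : WeightedDigraph V E R) (v : V) (T : Finset E) : Prop :=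
  ∀ w : V, ∃! p : List E, Γ.IsDirectedPath T w v p

open Classical in
/-- `A_v(Γ)`: the sum, over the arborescences rooted at `v`, of the product of the weights of
their edges. -/
noncomputable def arborescenceSum [Fintype E] [CommRing R] (Γ : WeightedDigraph V E R) (v : V) :
    R :=
  ∑ T : Finset E with Γ.IsArborescence v T, ∏ e ∈ T, Γ.wt e

end WeightedDigraph

/-- A weighted directed multigraph each of whose edges carries a voltage in `G`. -/
structure VoltageGraph (V E R G : Type*) extends WeightedDigraph V E R where
  /-- the voltage of an edge -/
  voltage : E → G

/-- The reduced group algebra of a finite abelian group `G` over `R`: the group algebra `R[G]`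
modulo the ideal generated by the sum of all elements of `G`. -/
abbrev ReducedGroupAlgebra (R G : Type*) [CommRing R] [CommGroup G] [Fintype G] : Type _ :=
  MonoidAlgebra R G ⧸
    Ideal.span ({∑ g : G, MonoidAlgebra.of R G g} : Set (MonoidAlgebra R G))

/-- The class in the reduced group algebra of a group element. -/
noncomputable def ReducedGroupAlgebra.ofGroup (R : Type*) {G : Type*} [CommRing R] [CommGroup G]
    [Fintype G] (g : G) : ReducedGroupAlgebra R G :=
  Ideal.Quotient.mk _ (MonoidAlgebra.of R G g)

namespace VoltageGraph

variable {V E R G : Type*}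

/-- The derived covering graph: the edge `e = (v, w)` lifts, for each `x` in `G`, to the edge
`(e, x)` from `(v, x)` to `(w, ν(e) x)`, of the same weight as `e`. -/
def derived [Group G] (Γ : VoltageGraph V E R G) : WeightedDigraph (V × G) (E × G) R where
  src e := (Γ.src e.1, e.2)
  tgt e := (Γ.tgt e.1, Γ.voltage e.1 * e.2)
  wt e := Γ.wt e.1

/-- The weighted degree matrix: its diagonal entry at `i` is the total weight of the edges with
source `i`. -/
def degreeMatrix [DecidableEq V] [Fintype E] [CommRing R] (Γ : VoltageGraph V E R G) :
    Matrix V V R :=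
  Matrix.diagonal fun i => ∑ e : E with Γ.src e = i, Γ.wt e

/-- The voltage adjacency matrix, with entries `∑ ν(e) wt(e)` over the edges `e` from `i`
to `j`. -/
noncomputable def voltageAdjacency [DecidableEq V] [Fintype E] [CommRing R] [CommGroup G]
    [Fintype G] (Γ : VoltageGraph V E R G) : Matrix V V (ReducedGroupAlgebra R G) :=
  Matrix.of fun i j => ∑ e : E with Γ.src e = i ∧ Γ.tgt e = j,
    ReducedGroupAlgebra.ofGroup R (Γ.voltage e) *
      algebraMap R (ReducedGroupAlgebra R G) (Γ.wt e)

/-- The voltage Laplacian: the weighted degree matrix minus the voltage adjacency matrix. -/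
noncomputable def voltageLaplacian [DecidableEq V] [Fintype E] [CommRing R] [CommGroup G]
    [Fintype G] (Γ : VoltageGraph V E R G) : Matrix V V (ReducedGroupAlgebra R G) :=
  Γ.degreeMatrix.map (algebraMap R (ReducedGroupAlgebra R G)) - Γ.voltageAdjacency

end VoltageGraph

/-- The character of `ℤ/2ℤ` (written multiplicatively) with values in `R` that sends the
non-identity element to `-1`. -/
def signCharacter (R : Type*) [CommRing R] : Multiplicative (ZMod 2) →* R where
  toFun g := if g = 1 then 1 else -1
  map_one' := by simp
  map_mul' := by
    have h : ∀ g : Multiplicative (ZMod 2), g = 1 ∨ g = Multiplicative.ofAdd 1 := by decide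
    have h1 : Multiplicative.ofAdd (1 : ZMod 2) ≠ 1 := by decide
    have h2 : Multiplicative.ofAdd (1 : ZMod 2) * Multiplicative.ofAdd (1 : ZMod 2) = 1 := by
      decide
    intro a b
    rcases h a with rfl | rfl <;> rcases h b with rfl | rfl <;> simp [h1, h2]

/-- The homomorphism from the reduced group algebra of `ℤ/2ℤ` to `R` that extends the character
above. -/
noncomputable def reducedSignHom (R : Type*) [CommRing R] :
    ReducedGroupAlgebra R (Multiplicative (ZMod 2)) →ₐ[R] R :=
  Ideal.Quotient.liftₐ _ (MonoidAlgebra.lift R R (Multiplicative (ZMod 2)) (signCharacter R)) <| by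
    have hu : (Finset.univ : Finset (Multiplicative (ZMod 2))) = {1, Multiplicative.ofAdd 1} := by
      decide
    have h1 : Multiplicative.ofAdd (1 : ZMod 2) ≠ 1 := by decide
    intro a ha
    rw [← RingHom.mem_ker]
    refine (Ideal.span_le.2 ?_ : Ideal.span _ ≤ RingHom.ker
      (MonoidAlgebra.lift R R (Multiplicative (ZMod 2)) (signCharacter R))) ha
    rintro _ rfl
    rw [SetLike.mem_coe, RingHom.mem_ker, hu, Finset.sum_pair h1.symm]
    simp [signCharacter, h1]

theorem reducedSignHom_ofGroup (R : Type*) [CommRing R] (g : Multiplicative (ZMod 2)) :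
    reducedSignHom R (ReducedGroupAlgebra.ofGroup R g) = signCharacter R g :=
  MonoidAlgebra.lift_of (signCharacter R) g

theorem ReducedGroupAlgebra.ofGroup_eq_signCharacter (R : Type*) [CommRing R]
    (g : Multiplicative (ZMod 2)) :
    ReducedGroupAlgebra.ofGroup R g =
      algebraMap R (ReducedGroupAlgebra R (Multiplicative (ZMod 2))) (signCharacter R g) := by
  have h : ∀ g : Multiplicative (ZMod 2), g = 1 ∨ g = Multiplicative.ofAdd 1 := by decide
  have hu : (Finset.univ : Finset (Multiplicative (ZMod 2))) = {1, Multiplicative.ofAdd 1} := by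
    decide
  have h1 : Multiplicative.ofAdd (1 : ZMod 2) ≠ 1 := by decide
  have hone : ReducedGroupAlgebra.ofGroup R (1 : Multiplicative (ZMod 2)) = 1 := by
    rw [ReducedGroupAlgebra.ofGroup, map_one, map_one]
  rcases h g with rfl | rfl
  · rw [hone, map_one, map_one]
  · have hs : ReducedGroupAlgebra.ofGroup R (1 : Multiplicative (ZMod 2)) +
        ReducedGroupAlgebra.ofGroup R (Multiplicative.ofAdd (1 : ZMod 2)) = 0 := by
      rw [ReducedGroupAlgebra.ofGroup, ReducedGroupAlgebra.ofGroup, ← map_add,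
        Ideal.Quotient.eq_zero_iff_mem]
      refine Ideal.subset_span ?_
      rw [Set.mem_singleton_iff, hu, Finset.sum_pair h1.symm]
    have hc : signCharacter R (Multiplicative.ofAdd (1 : ZMod 2)) = -1 := by
      simp [signCharacter, h1]
    rw [hone] at hs
    rw [hc, RingHom.map_neg, RingHom.map_one]
    exact (neg_eq_of_add_eq_zero_right hs).symm

/-- The identification of the reduced group algebra of `ℤ/2ℤ` over `R` with `R`; the non-identity
element of `ℤ/2ℤ` becomes `-1`. -/
noncomputable def reducedSignEquiv (R : Type*) [CommRing R] :
    ReducedGroupAlgebra R (Multiplicative (ZMod 2)) ≃ₐ[R] R :=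
  AlgEquiv.ofAlgHom (reducedSignHom R) (Algebra.ofId R _) (by ext) (by
    have key : ∀ y, (Algebra.ofId R (ReducedGroupAlgebra R (Multiplicative (ZMod 2)))).comp
        (reducedSignHom R) (Ideal.Quotient.mkₐ R _ y) = Ideal.Quotient.mkₐ R _ y := by
      intro y
      have : ((Algebra.ofId R (ReducedGroupAlgebra R (Multiplicative (ZMod 2)))).comp
          (reducedSignHom R)).comp (Ideal.Quotient.mkₐ R _) = Ideal.Quotient.mkₐ R _ := by
        refine MonoidAlgebra.algHom_ext (fun g => ?_) (by ext)
        change algebraMap R _ (reducedSignHom R (ReducedGroupAlgebra.ofGroup R g)) =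
          ReducedGroupAlgebra.ofGroup R g
        rw [reducedSignHom_ofGroup, ReducedGroupAlgebra.ofGroup_eq_signCharacter]
      exact DFunLike.congr_fun this y
    refine AlgHom.ext fun z => ?_
    obtain ⟨y, rfl⟩ := Ideal.Quotient.mkₐ_surjective R _ z
    exact key y)

theorem reducedSignEquiv_ofGroup_ofAdd_one (R : Type*) [CommRing R] :
    reducedSignEquiv R (ReducedGroupAlgebra.ofGroup R (Multiplicative.ofAdd (1 : ZMod 2))) =
      -1 := by
  rw [ReducedGroupAlgebra.ofGroup_eq_signCharacter, AlgEquiv.commutes]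
  have h1 : Multiplicative.ofAdd (1 : ZMod 2) ≠ 1 := by decide
  simp [signCharacter, h1]

/-- The voltage Laplacian of a `ℤ/2ℤ`-voltage graph as a matrix over the ring of weights, through
the identification of the reduced group algebra of `ℤ/2ℤ` over `R` with `R`. -/
noncomputable def VoltageGraph.signedLaplacian {V E R : Type*} [DecidableEq V] [Fintype E]
    [CommRing R] (Γ : VoltageGraph V E R (Multiplicative (ZMod 2))) : Matrix V V R :=
  Γ.voltageLaplacian.map (reducedSignEquiv R)

/-! ### Determinants of two-sheeted block matrices -/

namespace Matrix

variable {n S : Type*} [Fintype n] [DecidableEq n] [CommRing S]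

/-! Listing the double cover by sheets turns its Laplacian into `fromBlocks P Q Q P`, where `P + Q`
is the Laplacian of the base and `P - Q` the signed one; its determinant factors as `det (P + Q) *
det (P - Q)`. By the matrix-tree theorem (`arborescenceSum_eq_det`), arborescence sums are
determinants of the Laplacian with the root row replaced by a basis vector.

Both sides of the factorization vanish, since `det (P + Q) = 0`, so it is differentiated: add `t` to
the `(v, v)` entry of `P` and compare coefficients of `t`. On the left both lifts of `v` contribute,
equally by the symmetry of the sheets, whence the factor 2. On the right only the derivative of `det
(P + Q)` survives, times `det (P - Q)`. Dual numbers make this exact over any commutative ring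
(`two_mul_det_updateRow_fromBlocks`). -/

theorem det_fromBlocks_circulant (P Q : Matrix n n S) :
    (fromBlocks P Q Q P).det = (P + Q).det * (P - Q).det := by
  -- Add the second block row to the first, then subtract the first block column from the second.
  have h : fromBlocks 1 1 0 1 * fromBlocks P Q Q P * fromBlocks 1 (-1) 0 1 =
      fromBlocks (P + Q) 0 Q (P - Q) := by
    rw [fromBlocks_multiply, fromBlocks_multiply]
    congr 1 <;> simp <;> abel
  have h' := congrArg det h
  rw [det_mul, det_mul, det_fromBlocks_zero₂₁, det_fromBlocks_zero₂₁,
    det_fromBlocks_zero₁₂] at h'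
  simpa using h'

theorem det_updateRow_add_smul (M : Matrix n n S) (i : n) (t : S) (u : n → S) :
    (M.updateRow i (M i + t • u)).det = M.det + t * (M.updateRow i u).det := by
  rw [det_updateRow_add, det_updateRow_smul, updateRow_eq_self]

/-- Ordered by `d`, the matrix is block lower triangular (hence `OrderDual`), and its diagonal
blocks, the level sets of `d`, are identities. -/
theorem det_eq_one_of_lt {M : Matrix n n S} (d : n → ℕ)
    (h : ∀ i j, d i ≤ d j → M i j = (1 : Matrix n n S) i j) : M.det = 1 := by
  have hM : M.BlockTriangular (OrderDual.toDual ∘ d) := fun i j hij => by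
    have hij' : d i < d j := hij
    rw [h i j hij'.le, one_apply_ne]
    rintro rfl
    exact hij'.false
  rw [hM.det]
  refine Finset.prod_eq_one fun a _ => ?_
  have hblock : M.toSquareBlock (OrderDual.toDual ∘ d) a = 1 := by
    ext i j
    rw [toSquareBlock_def, of_apply, h, one_apply, one_apply]
    · simp only [Subtype.ext_iff]
    · exact (OrderDual.toDual.injective (i.2.trans j.2.symm)).le
  rw [hblock, det_one]

/-- The adjugate gives `det M • u = 0`; an entry equal to 1 replaces cancellation, as `S` may have
zero divisors. -/
theorem det_eq_zero_of_mulVec_eq_zero {M : Matrix n n S} {u : n → S} (h : M *ᵥ u = 0) {i : n}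
    (hi : u i = 1) : M.det = 0 := by
  have h' : M.adjugate *ᵥ (M *ᵥ u) = M.det • u := by
    rw [mulVec_mulVec, adjugate_mul, smul_mulVec, one_mulVec]
  simpa [h, hi] using (congrFun h' i).symm

/-- Exchanging the two sheets preserves the block matrix. -/
theorem det_updateRow_inr_fromBlocks (P Q : Matrix n n S) (v : n) :
    ((fromBlocks P Q Q P).updateRow (Sum.inr v) (Pi.single (Sum.inr v) 1)).det =
      ((fromBlocks P Q Q P).updateRow (Sum.inl v) (Pi.single (Sum.inl v) 1)).det := by
  rw [← det_submatrix_equiv_self (Equiv.sumComm n n)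
    ((fromBlocks P Q Q P).updateRow (Sum.inl v) (Pi.single (Sum.inl v) 1))]
  congr 1
  ext (i | i) (j | j) <;> simp [updateRow_apply, Pi.single_apply]

theorem mul_det_updateRow_fromBlocks (P Q : Matrix n n S) (v : n) (h : (P + Q).det = 0) {t : S}
    (ht : t * t = 0) :
    t * (2 * ((fromBlocks P Q Q P).updateRow (Sum.inl v) (Pi.single (Sum.inl v) 1)).det) =
      t * (((P + Q).updateRow v (Pi.single v 1)).det * (P - Q).det) := by
  set K := fromBlocks P Q Q P with hK
  set P' := P.updateRow v (P v + t • Pi.single v 1) with hP'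
  -- Perturbing `P` changes two rows of the block matrix, one for each lift of `v`.
  have hrow : fromBlocks P' Q Q P' =
      (K.updateRow (Sum.inl v) (K (Sum.inl v) + t • Pi.single (Sum.inl v) 1)).updateRow (Sum.inr v)
        ((K.updateRow (Sum.inl v) (K (Sum.inl v) + t • Pi.single (Sum.inl v) 1)) (Sum.inr v) +
          t • Pi.single (Sum.inr v) 1) := by
    ext (i | i) (j | j) <;> by_cases hi : i = v <;>
      simp [K, P', updateRow_apply, Pi.single_apply, hi]
  have hadd : P' + Q = (P + Q).updateRow v ((P + Q) v + t • Pi.single v 1) := by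
    ext i j
    by_cases hi : i = v
    · subst hi; simp [P']; ring
    · simp [P', hi]
  have hsub : P' - Q = (P - Q).updateRow v ((P - Q) v + t • Pi.single v 1) := by
    ext i j
    by_cases hi : i = v
    · subst hi; simp [P']; ring
    · simp [P', hi]
  have hdet := det_fromBlocks_circulant P' Q
  have hswap : ((K.updateRow (Sum.inl v) (K (Sum.inl v) + t • Pi.single (Sum.inl v) 1)).updateRow
      (Sum.inr v) (Pi.single (Sum.inr v) 1)).det =
      (K.updateRow (Sum.inr v) (Pi.single (Sum.inr v) 1)).det + t *
        ((K.updateRow (Sum.inr v) (Pi.single (Sum.inr v) 1)).updateRow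
          (Sum.inl v) (Pi.single (Sum.inl v) 1)).det := by
    rw [← det_updateRow_add_smul, updateRow_comm _ (by simp)]
    simp
  have hK0 : K.det = 0 := by rw [hK, det_fromBlocks_circulant, h, zero_mul]
  rw [hrow, det_updateRow_add_smul, det_updateRow_add_smul, hswap, hadd, hsub,
    det_updateRow_add_smul, det_updateRow_add_smul, h, hK0, hK,
    det_updateRow_inr_fromBlocks] at hdet
  -- The coefficient of `ht` collects the second-order terms of both sides.
  linear_combination hdet + (((P + Q).updateRow v (Pi.single v 1)).det *
    ((P - Q).updateRow v (Pi.single v 1)).det -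
    (((fromBlocks P Q Q P).updateRow (Sum.inr v) (Pi.single (Sum.inr v) 1)).updateRow
          (Sum.inl v) (Pi.single (Sum.inl v) 1)).det) * ht

theorem two_mul_det_updateRow_fromBlocks (P Q : Matrix n n S) (v : n) (h : (P + Q).det = 0) :
    2 * ((fromBlocks P Q Q P).updateRow (Sum.inl v) (Pi.single (Sum.inl v) 1)).det =
      ((P + Q).updateRow v (Pi.single v 1)).det * (P - Q).det := by
  let f : S →+* DualNumber S := algebraMap S (DualNumber S)
  have hadd : P.map f + Q.map f = (P + Q).map f := by ext1; simp
  have hsub : P.map f - Q.map f = (P - Q).map f := by ext1; simp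
  have hsingle {m : Type _} [DecidableEq m] (i : m) :
      (Pi.single i 1 : m → DualNumber S) = f ∘ Pi.single i 1 := by
    ext1 j
    by_cases hj : j = i <;> simp [hj]
  have key := mul_det_updateRow_fromBlocks (P.map f) (Q.map f) v
    (by rw [hadd]; simpa [h] using (f.map_det (P + Q)).symm) (DualNumber.eps_mul_eps (R := S))
  rw [← fromBlocks_map, hsingle, hsingle, ← map_updateRow, hadd, hsub, ← map_updateRow] at key
  simp only [← RingHom.mapMatrix_apply, ← RingHom.map_det] at key
  rw [← map_ofNat f 2, ← map_mul, ← map_mul] at key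
  -- Both sides of `key` are `ε` times an element of `S`, which the second component recovers.
  simpa [f, TrivSqZeroExt.algebraMap_eq_inl] using congrArg TrivSqZeroExt.snd key

end Matrix

/-! ### The matrix-tree theorem for directed multigraphs -/

namespace WeightedDigraph

variable {V E R : Type*} (Γ : WeightedDigraph V E R)

/-- The Laplacian of a weighted directed multigraph. -/
def laplacian [DecidableEq V] [Fintype E] [CommRing R] : Matrix V V R :=
  Matrix.of fun i => ∑ e : E with Γ.src e = i, Γ.wt e • (Pi.single i 1 - Pi.single (Γ.tgt e) 1)

theorem laplacian_row [DecidableEq V] [Fintype E] [CommRing R] (i : V) :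
    Γ.laplacian i =
      ∑ e : E with Γ.src e = i, Γ.wt e • (Pi.single i 1 - Pi.single (Γ.tgt e) 1 : V → R) :=
  rfl

theorem laplacian_apply [DecidableEq V] [Fintype E] [CommRing R] (i j : V) :
    Γ.laplacian i j = ∑ e : E with Γ.src e = i,
      Γ.wt e * ((if j = i then 1 else 0) - if j = Γ.tgt e then 1 else 0) := by
  simp [laplacian_row, Finset.sum_apply, Pi.single_apply]

theorem det_laplacian [Fintype V] [DecidableEq V] [Nonempty V] [Fintype E] [CommRing R] :
    Γ.laplacian.det = 0 := by
  refine Matrix.det_eq_zero_of_mulVec_eq_zero (u := 1) ?_ (i := Classical.arbitrary V) rfl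
  ext i
  simp only [Matrix.mulVec, dotProduct, laplacian_apply, Pi.one_apply, mul_one, Pi.zero_apply]
  rw [Finset.sum_comm]
  refine Finset.sum_eq_zero fun e _ => ?_
  rw [← Finset.mul_sum, Finset.sum_sub_distrib]
  simp

/-- A choice function `r` selects at every vertex other than the root `v` an edge leaving it. -/
def IsSelection (v : V) (r : V → Option E) : Prop :=
  ∀ w, (r w = none ↔ w = v) ∧ ∀ e, r w = some e → Γ.src e = w

open Classical in
/-- The set of the edges selected by a choice function. -/
noncomputable def selectedEdges [Fintype E] (r : V → Option E) : Finset E :=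
  {e : E | r (Γ.src e) = some e}

variable {Γ}

theorem mem_selectedEdges [Fintype E] {r : V → Option E} {e : E} :
    e ∈ Γ.selectedEdges r ↔ r (Γ.src e) = some e := by
  simp [selectedEdges]

theorem IsSelection.eq_some_iff [Fintype E] {v : V} {r : V → Option E} (hr : Γ.IsSelection v r)
    {w : V} {e : E} : r w = some e ↔ e ∈ Γ.selectedEdges r ∧ Γ.src e = w := by
  rw [mem_selectedEdges]
  constructor
  · intro h
    have := (hr w).2 e h
    exact ⟨this ▸ h, this⟩
  · rintro ⟨h, rfl⟩
    exact h

theorem IsSelection.path_unique [Fintype E] {v : V} {r : V → Option E} (hr : Γ.IsSelection v r)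
    (p : List E) : ∀ (w : V) (q : List E), Γ.IsDirectedPath (Γ.selectedEdges r) w v p →
      Γ.IsDirectedPath (Γ.selectedEdges r) w v q → p = q := by
  have hv : ∀ e ∈ Γ.selectedEdges r, Γ.src e ≠ v := fun e he h => by
    have := mem_selectedEdges.1 he
    rw [((hr _).1).2 h] at this
    simp at this
  induction p with
  | nil =>
    rintro _ (_ | ⟨e, q⟩) hp hq
    · rfl
    · exact absurd (hq.2.1.trans hp) (hv e hq.1)
  | cons e p ih =>
    rintro w (_ | ⟨e', q⟩) hp hq
    · exact absurd (hp.2.1.trans hq) (hv e hp.1)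
    · have h1 := hr.eq_some_iff.2 ⟨hp.1, hp.2.1⟩
      have h2 := hr.eq_some_iff.2 ⟨hq.1, hq.2.1⟩
      obtain rfl : e = e' := Option.some_injective _ (h1.symm.trans h2)
      rw [ih _ _ hp.2.2 hq.2.2]

theorem IsSelection.isArborescence_iff [Fintype E] {v : V} {r : V → Option E}
    (hr : Γ.IsSelection v r) : Γ.IsArborescence v (Γ.selectedEdges r) ↔
      ∀ w, ∃ p, Γ.IsDirectedPath (Γ.selectedEdges r) w v p :=
  forall_congr' fun w =>
    ⟨fun h => h.exists, fun ⟨p, hp⟩ => ⟨p, hp, fun _ hq => hr.path_unique _ _ _ hq hp⟩⟩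

theorem IsArborescence.exists_selection [Fintype E] {v : V} {T : Finset E}
    (hT : Γ.IsArborescence v T) : ∃ r, Γ.IsSelection v r ∧ Γ.selectedEdges r = T := by
  choose p hp hu using hT
  have hcons : ∀ e ∈ T, p (Γ.src e) = e :: p (Γ.tgt e) := fun e he =>
    (hu (Γ.src e) (e :: p (Γ.tgt e)) ⟨he, rfl, hp _⟩).symm
  have hroot : p v = [] := (hu v [] rfl).symm
  refine ⟨fun w => (p w).head?, fun w => ⟨?_, fun e he => ?_⟩, ?_⟩
  · have := hp w
    constructor
    · intro h
      rw [List.head?_eq_none_iff.1 h] at this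
      exact this
    · rintro rfl
      simp [hroot]
  · have := hp w
    obtain ⟨q, hq⟩ := List.head?_eq_some_iff.1 he
    rw [hq] at this
    exact this.2.1
  · ext e
    rw [mem_selectedEdges]
    constructor
    · intro he
      have := hp (Γ.src e)
      obtain ⟨q, hq⟩ := List.head?_eq_some_iff.1 he
      rw [hq] at this
      exact this.1
    · intro he
      simp [hcons e he]

theorem IsSelection.prod_selectedEdges [Fintype V] [Fintype E] [CommRing R] {v : V}
    {r : V → Option E} (hr : Γ.IsSelection v r) :
    ∏ e ∈ Γ.selectedEdges r, Γ.wt e = ∏ w, (r w).elim 1 Γ.wt := by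
  classical
  have himg : ∏ w ∈ (Γ.selectedEdges r).image Γ.src, (r w).elim 1 Γ.wt =
      ∏ e ∈ Γ.selectedEdges r, Γ.wt e := by
    rw [Finset.prod_image]
    · refine Finset.prod_congr rfl fun e he => ?_
      rw [mem_selectedEdges.1 he, Option.elim_some]
    · intro e he e' he' h
      have h1 := mem_selectedEdges.1 he
      rw [h, mem_selectedEdges.1 he'] at h1
      exact (Option.some_injective _ h1).symm
  rw [← himg]
  refine Finset.prod_subset (Finset.subset_univ _) fun w _ hw => ?_
  rcases h : r w with _ | e
  · rfl
  · obtain ⟨h1, h2⟩ := hr.eq_some_iff.1 h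
    exact absurd (Finset.mem_image.2 ⟨e, h1, h2⟩) hw

variable (Γ) in
/-- The matrix whose row at `w` is the basis vector of `w` minus the basis vector of the target
of the edge selected at `w`, if any. -/
def selectionMatrix [DecidableEq V] [CommRing R] (r : V → Option E) : Matrix V V R :=
  Matrix.of fun i => Pi.single i 1 - (r i).elim 0 fun e => Pi.single (Γ.tgt e) 1

theorem selectionMatrix_apply [DecidableEq V] [CommRing R] (r : V → Option E) (i : V) :
    Γ.selectionMatrix r i = Pi.single i 1 - (r i).elim 0 fun e => Pi.single (Γ.tgt e) 1 :=
  rfl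

/-- Each selected edge shortens the path to the root, so the matrix is unitriangular for path
length. -/
theorem IsSelection.det_selectionMatrix_of_isArborescence [Fintype V] [DecidableEq V] [Fintype E]
    [CommRing R] {v : V} {r : V → Option E} (hr : Γ.IsSelection v r)
    (h : Γ.IsArborescence v (Γ.selectedEdges r)) : (Γ.selectionMatrix r).det = 1 := by
  choose p hp hu using h
  have hlen : ∀ w e, r w = some e → (p (Γ.tgt e)).length < (p w).length := by
    intro w e he
    obtain ⟨h1, rfl⟩ := hr.eq_some_iff.1 he
    rw [← hu (Γ.src e) (e :: p (Γ.tgt e)) ⟨h1, rfl, hp _⟩]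
    simp
  refine Matrix.det_eq_one_of_lt (fun w => (p w).length) fun i j hij => ?_
  rw [selectionMatrix_apply, Pi.sub_apply, ← Matrix.one_eq_pi_single, sub_eq_self]
  rcases hi : r i with _ | e
  · rfl
  · rw [Option.elim_some]
    refine Pi.single_eq_of_ne ?_ 1
    rintro rfl
    exact absurd (hlen i e hi) hij.not_gt

theorem IsSelection.det_selectionMatrix_of_not_isArborescence [Fintype V] [DecidableEq V]
    [Fintype E] [CommRing R] {v : V} {r : V → Option E} (hr : Γ.IsSelection v r)
    (h : ¬ Γ.IsArborescence v (Γ.selectedEdges r)) : (Γ.selectionMatrix r).det = 0 := by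
  classical
  rw [hr.isArborescence_iff, not_forall] at h
  obtain ⟨w, hw⟩ := h
  -- The indicator of the vertices that cannot reach the root is in the kernel: it vanishes at the
  -- root and agrees at both ends of a selected edge.
  refine Matrix.det_eq_zero_of_mulVec_eq_zero (i := w)
    (u := fun w => if ∃ p, Γ.IsDirectedPath (Γ.selectedEdges r) w v p then 0 else 1) ?_
    (if_neg hw)
  ext i
  change Γ.selectionMatrix r i ⬝ᵥ _ = 0
  rw [selectionMatrix_apply, sub_dotProduct, single_dotProduct, one_mul, sub_eq_zero]
  rcases hi : r i with _ | e
  · rw [Option.elim_none, zero_dotProduct]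
    exact if_pos ⟨[], (hr i).1.1 hi⟩
  · obtain ⟨h1, h2⟩ := hr.eq_some_iff.1 hi
    rw [Option.elim_some, single_dotProduct, one_mul]
    refine if_congr ⟨?_, fun ⟨p, hp⟩ => ⟨e :: p, h1, h2, hp⟩⟩ rfl rfl
    rintro ⟨_ | ⟨e', p⟩, hp⟩
    · rw [(hr i).1.2 hp] at hi
      simp at hi
    · have := hr.eq_some_iff.2 ⟨hp.1, hp.2.1⟩
      obtain rfl : e = e' := Option.some_injective _ (hi.symm.trans this)
      exact ⟨p, hp.2.2⟩

/-- The matrix-tree theorem for arborescences in weighted directed multigraphs. -/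
theorem arborescenceSum_eq_det [Fintype V] [DecidableEq V] [Fintype E] [CommRing R]
    (Γ : WeightedDigraph V E R) (v : V) :
    Γ.arborescenceSum v = (Γ.laplacian.updateRow v (Pi.single v 1)).det := by
  classical
  -- Each row is a sum over `A w`: the edges leaving `w`, or at the root only `none`, with weight 1
  -- and row `Pi.single v 1`. Multilinearity then expands the determinant over selections.
  let A : V → Finset (Option E) := fun w =>
    if w = v then {none} else ({e : E | Γ.src e = w} : Finset E).map Function.Embedding.some
  have hA : ∀ r : V → Option E, r ∈ Fintype.piFinset A ↔ Γ.IsSelection v r := by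
    intro r
    rw [Fintype.mem_piFinset]
    refine forall_congr' fun w => ?_
    by_cases hw : w = v
    · simp only [A, hw, if_true, Finset.mem_singleton]
      exact ⟨fun h => by simp [h], fun h => h.1.2 trivial⟩
    · simp only [A, hw, if_false, Finset.mem_map, Finset.mem_filter, Finset.mem_univ, true_and,
        Function.Embedding.some_apply, iff_false]
      constructor
      · rintro ⟨e, he, h⟩
        simp [← h, he]
      · rintro ⟨h1, h2⟩
        obtain ⟨e, he⟩ := Option.ne_none_iff_exists'.1 h1
        exact ⟨e, h2 e he, he.symm⟩
  let g : V → Option E → V → R := fun w o =>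
    o.elim 1 Γ.wt • (Pi.single w 1 - o.elim 0 fun e => Pi.single (Γ.tgt e) 1)
  have hrows : Γ.laplacian.updateRow v (Pi.single v 1) = fun w => ∑ o ∈ A w, g w o := by
    funext w
    by_cases hw : w = v
    · subst hw
      simp [A, g]
    · rw [Matrix.updateRow_ne hw]
      rw [laplacian_row]
      simp [A, g, hw]
  have hdet : (Γ.laplacian.updateRow v (Pi.single v 1)).det =
      ∑ r ∈ Fintype.piFinset A, (∏ w, (r w).elim 1 Γ.wt) * (Γ.selectionMatrix r).det := by
    rw [hrows]
    refine (Matrix.detRowAlternating.toMultilinearMap.map_sum_finset g A).trans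
      (Finset.sum_congr rfl fun r _ => ?_)
    exact Matrix.detRowAlternating.toMultilinearMap.map_smul_univ _ _
  rw [hdet, ← Finset.sum_filter_add_sum_filter_not _
    fun r => Γ.IsArborescence v (Γ.selectedEdges r), arborescenceSum]
  have hzero : ∑ r ∈ Fintype.piFinset A with ¬ Γ.IsArborescence v (Γ.selectedEdges r),
      (∏ w, (r w).elim 1 Γ.wt) * (Γ.selectionMatrix r).det = 0 := by
    refine Finset.sum_eq_zero fun r hr => ?_
    rw [Finset.mem_filter, hA] at hr
    rw [hr.1.det_selectionMatrix_of_not_isArborescence hr.2, mul_zero]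
  rw [hzero, add_zero]
  symm
  refine Finset.sum_nbij Γ.selectedEdges ?_ ?_ ?_ ?_
  · intro r hr
    simpa using (Finset.mem_filter.1 hr).2
  · intro r hr r' hr' h
    rw [Finset.mem_coe, Finset.mem_filter, hA] at hr hr'
    funext w
    ext e
    rw [hr.1.eq_some_iff, hr'.1.eq_some_iff, h]
  · intro T hT
    have hT' : Γ.IsArborescence v T := by simpa using hT
    obtain ⟨r, hr, rfl⟩ := hT'.exists_selection
    exact ⟨r, by simpa [hT'] using (hA r).2 hr, rfl⟩
  · intro r hr
    rw [Finset.mem_filter, hA] at hr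
    rw [hr.1.det_selectionMatrix_of_isArborescence hr.2, mul_one, hr.1.prod_selectedEdges]

end WeightedDigraph

/-! ### The Laplacian of the double cover in blocks -/

namespace VoltageGraph

variable {V E R : Type*} [DecidableEq V] [Fintype E] [CommRing R]

section Blocks

variable (Γ : VoltageGraph V E R (Multiplicative (ZMod 2)))

/-- The diagonal block of the Laplacian of the derived graph. -/
def diagonalBlock : Matrix V V R :=
  Matrix.of fun i j => ∑ e : E with Γ.src e = i, Γ.wt e * ((if j = i then 1 else 0) -
    if j = Γ.tgt e ∧ Γ.voltage e = 1 then 1 else 0)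

/-- The off-diagonal block of the Laplacian of the derived graph. -/
def offDiagonalBlock : Matrix V V R :=
  Matrix.of fun i j => ∑ e : E with Γ.src e = i, Γ.wt e *
    -(if j = Γ.tgt e ∧ Γ.voltage e ≠ 1 then 1 else 0)

theorem diagonalBlock_add_offDiagonalBlock :
    Γ.diagonalBlock + Γ.offDiagonalBlock = Γ.laplacian := by
  ext i j
  rw [Matrix.add_apply, diagonalBlock, offDiagonalBlock, Matrix.of_apply, Matrix.of_apply,
    ← Finset.sum_add_distrib, WeightedDigraph.laplacian_apply]
  refine Finset.sum_congr rfl fun e _ => ?_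
  rw [← mul_add]
  by_cases h1 : Γ.voltage e = 1 <;> simp [h1, sub_eq_add_neg]

/-- Subtracting the off-diagonal block flips the sign of exactly the edges of voltage `g`, as does
`g ↦ -1`. -/
theorem diagonalBlock_sub_offDiagonalBlock :
    Γ.diagonalBlock - Γ.offDiagonalBlock = Γ.signedLaplacian := by
  have hsign (g : Multiplicative (ZMod 2)) :
      reducedSignEquiv R (ReducedGroupAlgebra.ofGroup R g) = if g = 1 then 1 else -1 :=
    reducedSignHom_ofGroup R g
  ext i j
  simp only [signedLaplacian, voltageLaplacian, voltageAdjacency, degreeMatrix, Matrix.map_apply,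
    Matrix.sub_apply, Matrix.of_apply, map_sub, map_sum, map_mul, AlgEquiv.commutes, hsign,
    Algebra.algebraMap_self, RingHom.id_apply,
    Matrix.diagonal_apply, diagonalBlock, offDiagonalBlock]
  rw [← Finset.filter_filter, Finset.sum_filter (fun e => Γ.tgt e = j)]
  have hd : (if i = j then ∑ e : E with Γ.src e = i, Γ.wt e else 0) =
      ∑ e : E with Γ.src e = i, if i = j then Γ.wt e else 0 := by
    split_ifs <;> simp
  rw [hd, ← Finset.sum_sub_distrib, ← Finset.sum_sub_distrib]
  refine Finset.sum_congr rfl fun e _ => ?_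
  simp only [eq_comm (a := j)]
  by_cases h1 : Γ.voltage e = 1 <;> by_cases h2 : i = j <;> by_cases h3 : Γ.tgt e = j <;>
    simp [h1, h2, h3]

theorem laplacian_derived_apply (i j : V) (a b : Multiplicative (ZMod 2)) :
    Γ.derived.laplacian (i, a) (j, b) = if a = b then Γ.diagonalBlock i j
      else Γ.offDiagonalBlock i j := by
  -- A lifted edge stays on its sheet exactly when its voltage is trivial.
  have hg : ∀ g a b : Multiplicative (ZMod 2), b = g * a ↔ (a = b ↔ g = 1) := by decide
  rw [WeightedDigraph.laplacian_apply, Finset.sum_filter, Fintype.sum_prod_type]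
  simp only [derived, Prod.mk.injEq, ite_and, Finset.sum_ite_irrel, Finset.sum_const_zero,
    Finset.sum_ite_eq', Finset.mem_univ, if_true]
  rw [← Finset.sum_filter, ← apply_ite (fun M : Matrix V V R => M i j)]
  by_cases hab : a = b
  · rw [if_pos hab]
    refine Finset.sum_congr rfl fun e _ => ?_
    simp only [hg _ a b, eq_true hab, eq_true hab.symm, true_iff, ite_and, if_true]
  · rw [if_neg hab]
    refine Finset.sum_congr rfl fun e _ => ?_
    simp only [hg _ a b, hab, Ne.symm hab, false_iff, ite_and, if_false, ite_self, zero_sub]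

end Blocks

/-- The vertices of a double cover as two copies of the vertices of the base, the first copy being
the sheet of `x`. -/
noncomputable def sheetEquiv (V : Type*) (x : Multiplicative (ZMod 2)) :
    V ⊕ V ≃ V × Multiplicative (ZMod 2) :=
  Equiv.ofBijective
    (Sum.elim (fun v => (v, x)) fun v => (v, Multiplicative.ofAdd 1 * x)) <| by
    have h : ∀ x : Multiplicative (ZMod 2), x ≠ Multiplicative.ofAdd 1 * x := by decide
    have h' : ∀ x y : Multiplicative (ZMod 2), y = x ∨ y = Multiplicative.ofAdd 1 * x := by decide
    constructor
    · rintro (v | v) (w | w) hvw <;> simp_all [Prod.ext_iff]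
    · rintro ⟨v, y⟩
      rcases h' x y with rfl | rfl
      · exact ⟨Sum.inl v, rfl⟩
      · exact ⟨Sum.inr v, rfl⟩

/-- Since the sheet of `x` is listed first, the root is `Sum.inl v` for either lift. -/
theorem arborescenceSum_derived [Fintype V] (Γ : VoltageGraph V E R (Multiplicative (ZMod 2)))
    (v : V) (x : Multiplicative (ZMod 2)) :
    Γ.derived.arborescenceSum (v, x) =
      ((Matrix.fromBlocks Γ.diagonalBlock Γ.offDiagonalBlock Γ.offDiagonalBlock
        Γ.diagonalBlock).updateRow (Sum.inl v) (Pi.single (Sum.inl v) 1)).det := by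
  have h : ∀ x : Multiplicative (ZMod 2), x ≠ Multiplicative.ofAdd 1 * x := by decide
  rw [WeightedDigraph.arborescenceSum_eq_det, ← Matrix.det_submatrix_equiv_self (sheetEquiv V x)]
  congr 1
  have hl (i : V) : sheetEquiv V x (Sum.inl i) = (i, x) := rfl
  have hr (i : V) : sheetEquiv V x (Sum.inr i) = (i, Multiplicative.ofAdd 1 * x) := rfl
  ext (i | i) (j | j) <;>
    simp only [Matrix.submatrix_apply, hl, hr, Matrix.updateRow_apply, Pi.single_apply,
      laplacian_derived_apply, Prod.mk.injEq, h x, (h x).symm, if_true, if_false, and_true,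
      and_false, reduceCtorEq, Sum.inl.injEq, Matrix.fromBlocks_apply₁₁,
      Matrix.fromBlocks_apply₁₂, Matrix.fromBlocks_apply₂₁, Matrix.fromBlocks_apply₂₂]

end VoltageGraph

theorem corollary1p4 {V E R : Type*} [Fintype V] [DecidableEq V] [Fintype E] [CommRing R]
    (Γ : VoltageGraph V E R (Multiplicative (ZMod 2))) (v : V) (x : Multiplicative (ZMod 2)) :
    2 * Γ.derived.arborescenceSum (v, x) =
        Γ.arborescenceSum v * Γ.signedLaplacian.det ∧
      ∀ [IsDomain R], (2 : R) ≠ 0 → Γ.arborescenceSum v ≠ 0 →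
        algebraMap R (FractionRing R) (Γ.derived.arborescenceSum (v, x)) /
            algebraMap R (FractionRing R) (Γ.arborescenceSum v) =
          1 / 2 * algebraMap R (FractionRing R) Γ.signedLaplacian.det := by
  have main : 2 * Γ.derived.arborescenceSum (v, x) =
      Γ.arborescenceSum v * Γ.signedLaplacian.det := by
    have : Nonempty V := ⟨v⟩
    rw [Γ.arborescenceSum_derived, Matrix.two_mul_det_updateRow_fromBlocks,
      Γ.diagonalBlock_add_offDiagonalBlock, Γ.diagonalBlock_sub_offDiagonalBlock,
      WeightedDigraph.arborescenceSum_eq_det]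
    rw [Γ.diagonalBlock_add_offDiagonalBlock, WeightedDigraph.det_laplacian]
  refine ⟨main, fun h2 hA => ?_⟩
  have hinj := IsFractionRing.injective R (FractionRing R)
  have h2' : (2 : FractionRing R) ≠ 0 := by
    have := (map_ne_zero_iff _ hinj).2 h2
    rwa [map_ofNat] at this
  have hA' := (map_ne_zero_iff _ hinj).2 hA
  have main' := congrArg (algebraMap R (FractionRing R)) main
  rw [map_mul, map_mul, map_ofNat] at main'
  rw [div_eq_iff hA', one_div, mul_assoc, eq_inv_mul_iff_mul_eq₀ h2', main', mul_comm]
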